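/- Let $R$ be an associative unital topological ring that is complete and separated (Hausdorff) and has a countable base of neighborhoods of zero consisting of open right ideals. For a set $X$, let $R[[X]]$ denote the set of all infinite formal linear combinations $\sum_{x\in X} a_x x$ whose coefficient families $(a_x)_{x\in X}$ in $R$ converge to zero (for every open right ideal $I$, all but finitely many $a_x$ lie in $I$). With the point-measure maps $X\to R[[X]]$ and the "opening of parentheses" maps $R[[R[[X]]]]\to R[[X]]$, defined by convergent infinite summation in $R$, the functor $X\mapsto R[[X]]$ is a monad on sets; a left $R$-contramodule is an algebra $P$ over this monad, with structure map (contraaction) $\pi_P\colon R[[P]]\to P$. Restricting $\pi_P$ to finite combinations makes $P$ a left $R$-module, in particular an abelian group. A right $R$-module $N$ is discrete if every element of $N$ is annihilated by some open right ideal of $R$. The contratensor product $N\odot_R P$ of a discrete right $R$-module $N$ and a left $R$-contramodule $P$ is the quotient of $N\otimes_{\mathbb Z}P$ by the subgroup generated by all elements $b\otimes\pi_P\bigl(\sum_x r_xp_x\bigr)-\sum_x br_x\otimes p_x$, where $b\in N$, $X$ is a set, $(r_x)_{x\in X}$ is a family in $R$ converging to zero, and $(p_x)_{x\in X}$ is a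 family in $P$. The contramodule $P$ is flat if the functor $N\mapsto N\odot_R P$ from discrete right $R$-modules to abelian groups is exact. For an open right ideal $I\subseteq R$, let $I\rightthreetimes P\subseteq P$ be the image under $\pi_P$ of the subgroup $I[[P]]\subseteq R[[P]]$ of formal combinations with coefficients in $I$. The contramodule $P$ is separated if $\bigcap_I (I\rightthreetimes P)=0$, the intersection being over all open right ideals $I$ of $R$. Then every flat left $R$-contramodule is separated. -/

import Mathlib

open Filter MulOpposite
open scoped Topology TensorProduct

universe u v w

namespace Contra

/-- `R[[X]]`: infinite formal linear combinations `∑ₓ aₓ x` of elements of the set `X`, with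
families of coefficients `aₓ` in `R` converging to zero (every neighbourhood of zero contains all
but finitely many of the `aₓ`). -/
def FormalSums (R : Type u) [Ring R] [TopologicalSpace R] [IsTopologicalRing R] (X : Type v) :
    AddSubgroup (X → R) where
  carrier := {a | Tendsto a cofinite (𝓝 0)}
  zero_mem' := tendsto_const_nhds
  add_mem' {a b} ha hb := by
    have h := Tendsto.add (show Tendsto a cofinite (𝓝 0) from ha)
      (show Tendsto b cofinite (𝓝 0) from hb)
    rw [add_zero] at h
    exact h
  neg_mem' {a} ha := by
    have h := Tendsto.neg (show Tendsto a cofinite (𝓝 0) from ha)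
    rw [neg_zero] at h
    exact h

namespace FormalSums

section Point

variable {R : Type u} [Ring R] [TopologicalSpace R] [IsTopologicalRing R] {X : Type v}

open Classical in
/-- The point measure `ε : X → R[[X]]`, sending `x` to the formal combination `1 · x`. -/
noncomputable def point (x : X) : FormalSums R X :=
  ⟨fun y => if y = x then 1 else 0, by
    refine tendsto_nhds_of_eventually_eq ?_
    rw [eventually_cofinite]
    refine (Set.finite_singleton x).subset fun y hy => ?_
    by_contra hne
    exact hy (if_neg hne)⟩

end Point

section Complete

variable {R : Type u} [Ring R] [UniformSpace R] [IsUniformAddGroup R] [IsTopologicalRing R]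
  [IsLinearTopology Rᵐᵒᵖ R] [CompleteSpace R]

theorem summable_of_tendsto {ι : Type v} {f : ι → R} (hf : Tendsto f cofinite (𝓝 0)) :
    Summable f := by
  have : NonarchimedeanAddGroup R := ⟨fun U hU => by
    obtain ⟨I, hI, hIU⟩ := (IsLinearTopology.hasBasis_open_submodule Rᵐᵒᵖ).mem_iff.mp hU
    exact ⟨⟨I.toAddSubgroup, hI⟩, hIU⟩⟩
  exact NonarchimedeanAddGroup.summable_of_tendsto_cofinite_zero hf

theorem tsum_mem_of_isOpen {ι : Type v} {f : ι → R} {I : Submodule Rᵐᵒᵖ R}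
    (hI : IsOpen (I : Set R)) (hf : ∀ i, f i ∈ I) : ∑' i, f i ∈ I := by
  have hc : IsClosed (I : Set R) := AddSubgroup.isClosed_of_isOpen I.toAddSubgroup hI
  by_cases hs : Summable f
  · exact hc.mem_of_tendsto hs.hasSum (Eventually.of_forall fun s => I.sum_mem fun i _ => hf i)
  · rw [tsum_eq_zero_of_not_summable hs]
    exact I.zero_mem

theorem tendsto_zero_iff {ι : Type v} {f : ι → R} :
    Tendsto f cofinite (𝓝 0) ↔
      ∀ I : Submodule Rᵐᵒᵖ R, IsOpen (I : Set R) → {i | f i ∉ I}.Finite := by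
  rw [(IsLinearTopology.hasBasis_open_submodule (M := R) Rᵐᵒᵖ).tendsto_right_iff]
  rfl

theorem summable_fiber {X : Type v} {Y : Type w} (f : X → Y) (a : FormalSums R X) (y : Y) :
    Summable fun x : {x // f x = y} => a.1 x :=
  summable_of_tendsto
    ((show Tendsto a.1 cofinite (𝓝 0) from a.2).comp Subtype.val_injective.tendsto_cofinite)

/-- The direct image map `R[[f]] : R[[X]] → R[[Y]]`, sending `∑ₓ aₓ x` to
`∑_y (∑_{f x = y} aₓ) y`. -/
noncomputable def map {X : Type v} {Y : Type w} (f : X → Y) (a : FormalSums R X) :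
    FormalSums R Y :=
  ⟨fun y => ∑' x : {x // f x = y}, a.1 x, by
    refine tendsto_zero_iff.2 fun I hI => ?_
    refine ((tendsto_zero_iff.1 a.2 I hI).image f).subset fun y hy => ?_
    by_contra hne
    refine hy (tsum_mem_of_isOpen hI fun x => ?_)
    by_contra hx
    exact hne ⟨x.1, hx, x.2⟩⟩

theorem tendsto_mul {ι : Type v} {a b : ι → R} (ha : Tendsto a cofinite (𝓝 0)) :
    Tendsto (fun i => a i * b i) cofinite (𝓝 0) := by
  refine tendsto_zero_iff.2 fun I hI => ((tendsto_zero_iff.1 ha) I hI).subset fun i hi h => hi ?_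
  exact I.smul_mem (op (b i)) h

theorem summable_join {X : Type v} (c : FormalSums R (FormalSums R X)) (x : X) :
    Summable fun b : FormalSums R X => c.1 b * b.1 x :=
  summable_of_tendsto (tendsto_mul c.2)

/-- The "opening of parentheses" map `φ : R[[R[[X]]]] → R[[X]]`: the coefficient at `x` of the
image of `∑_b c_b b` is `∑_b c_b bₓ`, the sum being the limit of finite partial sums in `R`. -/
noncomputable def join {X : Type v} (c : FormalSums R (FormalSums R X)) : FormalSums R X :=
  ⟨fun x => ∑' b : FormalSums R X, c.1 b * b.1 x, by
    refine tendsto_zero_iff.2 fun I hI => ?_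
    have hF := tendsto_zero_iff.1 c.2 I hI
    have key : ∀ b : FormalSums R X, {x | c.1 b * b.1 x ∉ I}.Finite := fun b => by
      have h : Tendsto (fun x => c.1 b * b.1 x) cofinite (𝓝 0) := by
        have h := Tendsto.const_mul (c.1 b) (show Tendsto b.1 cofinite (𝓝 0) from b.2)
        rwa [mul_zero] at h
      exact tendsto_zero_iff.1 h I hI
    refine (hF.biUnion fun b _ => key b).subset fun x hx => ?_
    by_contra hne
    refine hx (tsum_mem_of_isOpen hI fun b => ?_)
    by_cases hb : c.1 b ∈ I
    · exact I.smul_mem (op (b.1 x)) hb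
    · by_contra h
      exact hne (Set.mem_biUnion (show b ∈ {b | c.1 b ∉ I} from hb) h)⟩

variable [T2Space R]

theorem map_add {X : Type v} {Y : Type w} (f : X → Y) (a b : FormalSums R X) :
    map f (a + b) = map f a + map f b :=
  Subtype.ext <| funext fun y =>
    (summable_fiber f a y).tsum_add (summable_fiber f b y)

theorem map_neg {X : Type v} {Y : Type w} (f : X → Y) (a : FormalSums R X) :
    map f (-a) = -map f a :=
  Subtype.ext <| funext fun _ => tsum_neg

theorem map_point {X : Type v} {Y : Type w} (f : X → Y) (x : X) :
    map f (point x : FormalSums R X) = point (f x) := by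
  classical
  refine Subtype.ext <| funext fun y => ?_
  by_cases h : y = f x
  · subst h
    refine (tsum_eq_single (⟨x, rfl⟩ : {x' // f x' = f x}) fun z hz => ?_).trans ?_
    · exact if_neg fun h => hz (Subtype.ext h)
    · exact (if_pos rfl).trans (if_pos rfl).symm
  · refine (tsum_congr fun z => ?_).trans (tsum_zero.trans (if_neg h).symm)
    exact if_neg fun e => h (by rw [← e]; exact z.2.symm)

theorem join_add {X : Type v} (c d : FormalSums R (FormalSums R X)) :
    join (c + d) = join c + join d := by
  refine Subtype.ext <| funext fun x => ?_
  refine (tsum_congr fun b => ?_).trans ((summable_join c x).tsum_add (summable_join d x))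
  exact add_mul _ _ _

theorem join_neg {X : Type v} (c : FormalSums R (FormalSums R X)) :
    join (-c) = -join c := by
  refine Subtype.ext <| funext fun x => ?_
  refine (tsum_congr fun b => ?_).trans tsum_neg
  exact neg_mul _ _

theorem join_point {X : Type v} (a : FormalSums R X) : join (point a) = a := by
  classical
  refine Subtype.ext <| funext fun x => ?_
  refine (tsum_eq_single a fun b hb => ?_).trans ?_
  · exact (congrArg (· * b.1 x) (if_neg hb)).trans (zero_mul _)
  · exact (congrArg (· * a.1 x) (if_pos rfl)).trans (one_mul _)

end Complete

end FormalSums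

open FormalSums

/-- A left contramodule over `R`: an algebra over the monad `X ↦ R[[X]]` on sets, that is, a set
with a contraaction map `π : R[[P]] → P` satisfying contraassociativity and contraunitality. -/
structure LeftContramodule (R : Type u) [Ring R] [UniformSpace R] [IsUniformAddGroup R]
    [IsTopologicalRing R] [IsLinearTopology Rᵐᵒᵖ R] [CompleteSpace R] where
  /-- The underlying set. -/
  carrier : Type u
  /-- The contraaction map. -/
  π : FormalSums R carrier → carrier
  contraassoc : ∀ c : FormalSums R (FormalSums R carrier), π (join c) = π (map π c)
  contraunit : ∀ p : carrier, π (point p) = p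

/-- A right `R`-module `N` is discrete if every element of `N` is annihilated by some open right
ideal of `R`. -/
class IsDiscreteRightModule (R : Type u) [Ring R] [TopologicalSpace R] (N : Type v)
    [AddCommGroup N] [Module Rᵐᵒᵖ N] : Prop where
  exists_open_annihilator : ∀ b : N, ∃ I : Submodule Rᵐᵒᵖ R,
    IsOpen (I : Set R) ∧ ∀ r ∈ I, op r • b = 0

namespace LeftContramodule

variable {R : Type u} [Ring R] [UniformSpace R] [IsUniformAddGroup R]
    [IsTopologicalRing R] [IsLinearTopology Rᵐᵒᵖ R] [CompleteSpace R]

instance : CoeSort (LeftContramodule R) (Type u) := ⟨carrier⟩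

variable (P : LeftContramodule R)

/-- `∑ₓ rₓ pₓ ∈ P`: the contraaction applied to the image in `R[[P]]` of the formal combination
`∑ₓ rₓ x` in `R[[X]]` under the direct image map induced by `x ↦ pₓ`. -/
noncomputable def infSum {X : Type v} (r : FormalSums R X) (p : X → P) : P := P.π (map p r)

section AddCommGroup

variable [T2Space R]

/-! The underlying additive group: the operations are the contraaction applied to the finite
formal combinations `1 · p + 1 · q`, `0` and `(-1) · p`. -/

theorem π_add (a b : FormalSums R P) : P.π (a + b) = P.π (point (P.π a) + point (P.π b)) := by
  rw [← map_point, ← map_point, ← FormalSums.map_add, ← contraassoc, join_add, join_point, join_point]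

theorem π_neg (a : FormalSums R P) : P.π (-a) = P.π (-point (P.π a)) := by
  rw [← map_point, ← FormalSums.map_neg, ← contraassoc, join_neg, join_point]

noncomputable instance : Add P := ⟨fun p q => P.π (point p + point q)⟩

instance : Zero P := ⟨P.π 0⟩

noncomputable instance : Neg P := ⟨fun p => P.π (-point p)⟩

noncomputable instance : AddCommGroup P where
  add_assoc p q r := by
    change P.π (point (P.π (point p + point q)) + point r)
      = P.π (point p + point (P.π (point q + point r)))
    have h1 := P.π_add (point p + point q) (point r)
    have h2 := P.π_add (point p) (point q + point r)
    rw [P.contraunit] at h1 h2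
    rw [← h1, ← h2, add_assoc]
  zero_add p := by
    change P.π (point (P.π 0) + point p) = p
    have h := P.π_add 0 (point p)
    rw [P.contraunit] at h
    rw [← h, zero_add, P.contraunit]
  add_zero p := by
    change P.π (point p + point (P.π 0)) = p
    have h := P.π_add (point p) 0
    rw [P.contraunit] at h
    rw [← h, add_zero, P.contraunit]
  add_comm p q := congrArg P.π (add_comm (point p) (point q))
  neg_add_cancel p := by
    change P.π (point (P.π (-point p)) + point p) = P.π 0
    have h := P.π_add (-point p) (point p)
    rw [P.contraunit] at h
    rw [← h, neg_add_cancel]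
  nsmul := nsmulRec
  zsmul := zsmulRec

/-- `I ⋏ P`: the image of the subgroup `I[[P]] ⊆ R[[P]]` under the contraaction map. -/
def tim (I : Submodule Rᵐᵒᵖ R) : AddSubgroup P where
  carrier := {p | ∃ a : FormalSums R P, (∀ x, a.1 x ∈ I) ∧ P.π a = p}
  zero_mem' := ⟨0, fun _ => I.zero_mem, rfl⟩
  add_mem' := by
    rintro _ _ ⟨a, ha, rfl⟩ ⟨b, hb, rfl⟩
    exact ⟨a + b, fun x => I.add_mem (ha x) (hb x), P.π_add a b⟩
  neg_mem' := by
    rintro _ ⟨a, ha, rfl⟩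
    exact ⟨-a, fun x => I.neg_mem (ha x), P.π_neg a⟩

/-- A contramodule is separated if the intersection of the subgroups `I ⋏ P`, over all open right
ideals `I` of `R`, vanishes. -/
def IsSeparated : Prop :=
  ⨅ (I : Submodule Rᵐᵒᵖ R) (_ : IsOpen (I : Set R)), P.tim I = ⊥

section Contratensor

variable (N : Type v) [AddCommGroup N] [Module Rᵐᵒᵖ N]

/-- The subgroup of `N ⊗_ℤ P` generated by all the elements
`b ⊗ (∑ₓ rₓ pₓ) - ∑ₓ b rₓ ⊗ pₓ`, for families `rₓ` converging to zero in `R` and arbitrary families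
`pₓ` in `P`. When `N` is discrete, only finitely many of the `b rₓ` are nonzero. -/
noncomputable def contratensorRelations : AddSubgroup (N ⊗[ℤ] P) :=
  AddSubgroup.closure {t | ∃ (b : N) (X : Type u) (r : FormalSums R X) (p : X → P),
    t = b ⊗ₜ[ℤ] P.infSum r p - ∑ᶠ x, (op (r.1 x) • b) ⊗ₜ[ℤ] p x}

/-- The contratensor product `N ⊙_R P` of a discrete right `R`-module `N` and a left
`R`-contramodule `P`. -/
abbrev Contratensor [IsDiscreteRightModule R N] : Type (max u v) :=
  (N ⊗[ℤ] P) ⧸ P.contratensorRelations N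

variable {N}

theorem finite_support_smul [hN : IsDiscreteRightModule R N] {X : Type w} (r : FormalSums R X)
    (b : N) : {x | op (r.1 x) • b ≠ 0}.Finite := by
  obtain ⟨I, hI, h⟩ := hN.exists_open_annihilator b
  exact (tendsto_zero_iff.1 r.2 I hI).subset fun x hx hxI => hx (h _ hxI)

variable {N' : Type w} [AddCommGroup N'] [Module Rᵐᵒᵖ N']

/-- The homomorphism `N ⊙_R P → N' ⊙_R P`, `b ⊙ p ↦ f(b) ⊙ p`, induced by a morphism `f : N → N'`
of discrete right `R`-modules. -/
noncomputable def contratensorMap [IsDiscreteRightModule R N] [IsDiscreteRightModule R N']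
    (f : N →ₗ[Rᵐᵒᵖ] N') : P.Contratensor N →+ P.Contratensor N' :=
  QuotientAddGroup.map _ _
    (LinearMap.rTensor P f.toAddMonoidHom.toIntLinearMap).toAddMonoidHom <| by
    refine (AddSubgroup.closure_le _).2 ?_
    rintro _ ⟨b, X, r, p, rfl⟩
    refine AddSubgroup.subset_closure ⟨f b, X, r, p, ?_⟩
    rw [_root_.map_sub, AddMonoidHom.map_finsum]
    · simp
    · refine (finite_support_smul r b).subset fun x hx h0 => hx ?_
      simp only [h0, TensorProduct.zero_tmul]

end Contratensor

/-- A left contramodule `P` is flat if `N ↦ N ⊙_R P` is an exact functor on the abelian category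
of discrete right `R`-modules: it takes short exact sequences `0 → L → M → N → 0` of discrete right
modules to short exact sequences of abelian groups. -/
def IsFlat : Prop :=
  ∀ (L M N : Type u) [AddCommGroup L] [AddCommGroup M] [AddCommGroup N]
    [Module Rᵐᵒᵖ L] [Module Rᵐᵒᵖ M] [Module Rᵐᵒᵖ N]
    [IsDiscreteRightModule R L] [IsDiscreteRightModule R M] [IsDiscreteRightModule R N]
    (f : L →ₗ[Rᵐᵒᵖ] M) (g : M →ₗ[Rᵐᵒᵖ] N),
    Function.Injective f → Function.Exact f g → Function.Surjective g →
      Function.Injective (P.contratensorMap f) ∧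
      Function.Exact (P.contratensorMap f) (P.contratensorMap g) ∧
      Function.Surjective (P.contratensorMap g)

end AddCommGroup

end LeftContramodule

end Contra

/-! Write K for the kernel of π. For right ideals I and J with J open, flatness makes (I/(I∩J)) ⊙ P
→ (R/J) ⊙ P injective. If a ∈ I[[P]] and π(a) ∈ J ⋏ P, then a defines an element of the source whose
image is 1 ⊙ π(a) = 0, so that element vanishes. The assignment l ⊙ p ↦ l·p maps the source to
R[[P]] modulo J[[P]] and `kerSpan I`, the image of I[[K]] under opening of parentheses, and sends
that element to the class of a. Hence a ∈ J[[P]] + `kerSpan I` (`mem_sup_of_π_mem_tim`).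

Now let q lie in every Iₙ ⋏ P, for a decreasing base Iₙ. Starting from q = π(a₀) with a₀ ∈ I₀[[P]],
the step above yields aₙ ∈ Iₙ[[P]] with π(aₙ) = q and aₙ - aₙ₊₁ the image of some cₙ ∈ Iₙ[[K]]. By
completeness the cₙ sum to some d supported on K. Telescoping gives `join d` = a₀, and
contraassociativity evaluates q = π(`join d`) as a multiple of 0. -/

namespace Contra

namespace FormalSums

/-! ### Coefficientwise operations on formal sums. -/

section Scale

variable {R : Type u} [Ring R] [TopologicalSpace R] [IsTopologicalRing R] {X : Type v}

/-- Left multiplication of formal combinations by scalars, as a biadditive map. -/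
def scale : R →+ FormalSums R X →+ FormalSums R X :=
  AddMonoidHom.mk' (fun r => AddMonoidHom.mk' (fun a => ⟨fun x => r * a.1 x, by
      have h := Tendsto.const_mul r (show Tendsto a.1 cofinite (𝓝 0) from a.2)
      rwa [mul_zero] at h⟩)
    fun _ _ => Subtype.ext <| funext fun _ => mul_add _ _ _)
    fun _ _ => AddMonoidHom.ext fun _ => Subtype.ext <| funext fun _ => add_mul _ _ _

theorem scale_apply (r : R) (a : FormalSums R X) (x : X) : (scale r a).1 x = r * a.1 x := rfl

theorem point_apply_self (x : X) : (point x : FormalSums R X).1 x = 1 := if_pos rfl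

theorem point_apply_of_ne {x y : X} (h : y ≠ x) : (point x : FormalSums R X).1 y = 0 := if_neg h

/-- The subgroup `I[[X]]` of formal combinations with coefficients in `I`. -/
def coeffIn (I : Submodule Rᵐᵒᵖ R) (X : Type v) : AddSubgroup (FormalSums R X) where
  carrier := {a | ∀ x, a.1 x ∈ I}
  zero_mem' _ := I.zero_mem
  add_mem' ha hb x := I.add_mem (ha x) (hb x)
  neg_mem' ha x := I.neg_mem (ha x)

theorem scale_mem_coeffIn {I : Submodule Rᵐᵒᵖ R} {r : R} (hr : r ∈ I) (a : FormalSums R X) :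
    scale r a ∈ coeffIn I X := fun x => I.smul_mem (op (a.1 x)) hr

theorem sum_apply {ι : Type w} (s : Finset ι) (a : ι → FormalSums R X) (x : X) :
    (∑ i ∈ s, a i).1 x = ∑ i ∈ s, (a i).1 x := by
  rw [AddSubgroup.val_finsetSum, Finset.sum_apply]

theorem sub_sum_scale_point_mem {I : Submodule Rᵐᵒᵖ R} (a : FormalSums R X) (s : Finset X)
    (hs : ∀ x ∉ s, a.1 x ∈ I) : a - ∑ x ∈ s, scale (a.1 x) (point x) ∈ coeffIn I X := by
  intro y
  change a.1 y - (∑ x ∈ s, scale (a.1 x) (point x)).1 y ∈ I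
  rw [sum_apply]
  by_cases hy : y ∈ s
  · rw [Finset.sum_eq_single_of_mem y hy, scale_apply, point_apply_self, mul_one, sub_self]
    · exact I.zero_mem
    · intro x _ hx
      rw [scale_apply, point_apply_of_ne hx.symm, mul_zero]
  · rw [Finset.sum_eq_zero, sub_zero]
    · exact hs y hy
    · intro x hx
      rw [scale_apply, point_apply_of_ne, mul_zero]
      rintro rfl
      exact hy hx

theorem eq_zero_of_mem_coeffIn [T2Space R] {I : ℕ → Submodule Rᵐᵒᵖ R}
    (hI : (𝓝 (0 : R)).HasAntitoneBasis fun n => (I n : Set R)) {a : FormalSums R X}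
    (ha : ∀ n, a ∈ coeffIn (I n) X) : a = 0 := by
  refine Subtype.ext <| funext fun x => ?_
  change a.1 x = 0
  by_contra h
  obtain ⟨n, hn⟩ := hI.mem_iff.1 (isOpen_ne.mem_nhds (Ne.symm h) : {y | y ≠ a.1 x} ∈ 𝓝 0)
  exact hn (ha n x) rfl

end Scale

/-! ### Compatibility with the monad maps, and convergent series of formal sums. -/

section Complete

variable {R : Type u} [Ring R] [UniformSpace R] [IsUniformAddGroup R] [IsTopologicalRing R]
  [IsLinearTopology Rᵐᵒᵖ R] [CompleteSpace R] {X : Type v} {Y : Type w}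

theorem map_mem_coeffIn {I : Submodule Rᵐᵒᵖ R} (hI : IsOpen (I : Set R)) (f : X → Y)
    {a : FormalSums R X} (ha : a ∈ coeffIn I X) : map f a ∈ coeffIn I Y :=
  fun _ => tsum_mem_of_isOpen hI fun x => ha x.1

theorem join_mem_coeffIn {I : Submodule Rᵐᵒᵖ R} (hI : IsOpen (I : Set R))
    {c : FormalSums R (FormalSums R X)} (hc : c ∈ coeffIn I _) : join c ∈ coeffIn I X :=
  fun x => tsum_mem_of_isOpen hI fun b => I.smul_mem (op (b.1 x)) (hc b)

variable [T2Space R]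

theorem map_scale (f : X → Y) (r : R) (a : FormalSums R X) :
    map f (scale r a) = scale r (map f a) :=
  Subtype.ext <| funext fun y => (summable_fiber f a y).tsum_mul_left r

theorem join_scale (r : R) (c : FormalSums R (FormalSums R X)) :
    join (scale r c) = scale r (join c) := by
  refine Subtype.ext <| funext fun x => ?_
  refine (tsum_congr fun b => ?_).trans ((summable_join c x).tsum_mul_left r)
  exact mul_assoc _ _ _

/-- The map `join` as a homomorphism of additive groups. -/
noncomputable def joinHom (R : Type u) [Ring R] [UniformSpace R] [IsUniformAddGroup R]
    [IsTopologicalRing R] [IsLinearTopology Rᵐᵒᵖ R] [CompleteSpace R] [T2Space R] (X : Type v) :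
    FormalSums R (FormalSums R X) →+ FormalSums R X := AddMonoidHom.mk' join join_add

theorem map_sub_sum_scale_point_mem {I : Submodule Rᵐᵒᵖ R} (hI : IsOpen (I : Set R)) (f : X → Y)
    (a : FormalSums R X) (s : Finset X) (hs : ∀ x ∉ s, a.1 x ∈ I) :
    map f a - ∑ x ∈ s, scale (a.1 x) (point (f x)) ∈ coeffIn I Y := by
  have h := map_mem_coeffIn hI f (sub_sum_scale_point_mem a s hs)
  have e := _root_.map_sub (AddMonoidHom.mk' (map f) (map_add f)) a
    (∑ x ∈ s, scale (a.1 x) (point x))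
  rw [_root_.map_sum] at e
  simp only [AddMonoidHom.mk'_apply, map_scale, map_point] at e
  rwa [e] at h

/-- Completeness of R[[X]] in series form. The last clause keeps the support of the limit inside the
union of the supports, so a sum of combinations of elements of K is again one. -/
theorem exists_sub_sum_range_mem {I : ℕ → Submodule Rᵐᵒᵖ R}
    (hI : (𝓝 (0 : R)).HasAntitoneBasis fun n => (I n : Set R))
    (hIo : ∀ n, IsOpen (I n : Set R)) (a : ℕ → FormalSums R X)
    (ha : ∀ n, a n ∈ coeffIn (I n) X) :
    ∃ b : FormalSums R X, (∀ n, b - ∑ i ∈ Finset.range n, a i ∈ coeffIn (I n) X) ∧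
      ∀ x, (∀ n, (a n).1 x = 0) → b.1 x = 0 := by
  have hs : ∀ x, Summable fun n => (a n).1 x := fun x => by
    refine summable_of_tendsto ?_
    rw [Nat.cofinite_eq_atTop, hI.toHasBasis.tendsto_right_iff]
    intro n _
    filter_upwards [eventually_ge_atTop n] with k hk
    exact hI.antitone hk (ha k x)
  -- The difference is the tail of the series from index n; its terms lie in I n, which is closed
  -- because it is open.
  have key : ∀ n x, ∑' k, (a k).1 x - (∑ i ∈ Finset.range n, a i).1 x ∈ I n := fun n x => by
    rw [sum_apply, ← (hs x).sum_add_tsum_nat_add n, add_sub_cancel_left]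
    exact tsum_mem_of_isOpen (hIo n) fun k => hI.antitone (Nat.le_add_left n k) (ha _ x)
  refine ⟨⟨fun x => ∑' k, (a k).1 x, ?_⟩, key, fun x hx => ?_⟩
  · change Tendsto _ cofinite (𝓝 0)
    rw [hI.toHasBasis.tendsto_right_iff]
    intro n _
    -- A coefficient outside I n is already outside I n in the n-th partial sum, which has only
    -- finitely many of those.
    refine (tendsto_zero_iff.1 (∑ i ∈ Finset.range n, a i).2 (I n) (hIo n)).subset fun x hx h => hx ?_
    have := (I n).add_mem (key n x) h
    rwa [sub_add_cancel] at this
  · exact (tsum_congr hx).trans tsum_zero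

end Complete

end FormalSums

open FormalSums

/-! ### Discrete right modules: submodules, quotients and R/I. -/

section Discrete

variable {R : Type u} [Ring R] [TopologicalSpace R]

theorem IsDiscreteRightModule.of_injective {N : Type v} {N' : Type w} [AddCommGroup N]
    [Module Rᵐᵒᵖ N] [AddCommGroup N'] [Module Rᵐᵒᵖ N'] [h : IsDiscreteRightModule R N']
    (f : N →ₗ[Rᵐᵒᵖ] N') (hf : Function.Injective f) : IsDiscreteRightModule R N where
  exists_open_annihilator b := by
    obtain ⟨I, hI, hb⟩ := h.exists_open_annihilator (f b)
    exact ⟨I, hI, fun r hr => hf (by rw [map_smul, hb r hr, map_zero])⟩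

theorem IsDiscreteRightModule.of_surjective {N : Type v} {N' : Type w} [AddCommGroup N]
    [Module Rᵐᵒᵖ N] [AddCommGroup N'] [Module Rᵐᵒᵖ N'] [h : IsDiscreteRightModule R N]
    (f : N →ₗ[Rᵐᵒᵖ] N') (hf : Function.Surjective f) : IsDiscreteRightModule R N' where
  exists_open_annihilator b := by
    obtain ⟨b, rfl⟩ := hf b
    obtain ⟨I, hI, hb⟩ := h.exists_open_annihilator b
    exact ⟨I, hI, fun r hr => by rw [← map_smul, hb r hr, map_zero]⟩

theorem IsDiscreteRightModule.quotient [IsTopologicalRing R] {I : Submodule Rᵐᵒᵖ R}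
    (hI : IsOpen (I : Set R)) : IsDiscreteRightModule R (R ⧸ I) where
  exists_open_annihilator b := by
    obtain ⟨s, rfl⟩ := I.mkQ_surjective b
    let f : R →ₗ[Rᵐᵒᵖ] R :=
      { toFun := fun r => s * r
        map_add' := mul_add s
        map_smul' := fun t r => (mul_assoc s r t.unop).symm }
    -- The class of s is killed by every r with s * r ∈ I; these form an open right ideal by
    -- continuity of multiplication.
    refine ⟨I.comap f, hI.preimage (continuous_const_mul s), fun r hr => ?_⟩
    rw [← map_smul]
    exact (Submodule.Quotient.mk_eq_zero I).2 hr

end Discrete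

/-! ### The contraaction on combinations of elements of its kernel. -/

namespace LeftContramodule

variable {R : Type u} [Ring R] [UniformSpace R] [IsUniformAddGroup R]
    [IsTopologicalRing R] [IsLinearTopology Rᵐᵒᵖ R] [CompleteSpace R] [T2Space R]
    (P : LeftContramodule R)

/-- The contraaction as a homomorphism of additive groups. -/
noncomputable def πHom : FormalSums R P →+ P := AddMonoidHom.mk' P.π P.π_add

theorem πHom_apply (a : FormalSums R P) : P.πHom a = P.π a := rfl

theorem π_scale_of_π_eq_zero (r : R) {a : FormalSums R P} (ha : P.π a = 0) :
    P.π (scale r a) = 0 := by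
  -- By contraassociativity, π of r·b depends on b only through π(b), so b may be replaced by 0.
  have h (b : FormalSums R P) : P.π (scale r b) = P.π (scale r (point (P.π b))) := by
    rw [← map_point, ← map_scale, ← contraassoc, join_scale, join_point]
  rw [h a, ha, ← P.πHom.map_zero, πHom_apply, ← h 0, map_zero]

/-- Contraassociativity turns `join` into `map π`, which concentrates all coefficients of c at the
single point 0. -/
theorem π_join_eq_zero {c : FormalSums R (FormalSums R P)}
    (hc : ∀ b, P.π b ≠ 0 → c.1 b = 0) : P.π (join c) = 0 := by
  have h0 : P.π (point (0 : P)) = 0 := P.contraunit 0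
  have h : map P.π c = scale ((map P.π c).1 0) (point (0 : P)) := by
    refine Subtype.ext <| funext fun y => ?_
    by_cases hy : y = 0
    · rw [hy, scale_apply, point_apply_self, mul_one]
    · rw [scale_apply, point_apply_of_ne hy, mul_zero]
      refine (tsum_congr fun b : {b // P.π b = y} => hc b.1 ?_).trans tsum_zero
      rw [b.2]
      exact hy
  rw [contraassoc, h]
  exact P.π_scale_of_π_eq_zero _ h0

/-- The formal combinations, with coefficients in `I`, of elements of the kernel of the
contraaction. -/
def kerSums (I : Submodule Rᵐᵒᵖ R) : AddSubgroup (FormalSums R (FormalSums R P)) where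
  carrier := {c | c ∈ coeffIn I _ ∧ ∀ b, P.π b ≠ 0 → c.1 b = 0}
  zero_mem' := ⟨zero_mem _, fun _ _ => rfl⟩
  add_mem' ha hb := ⟨add_mem ha.1 hb.1, fun b h => by
    change _ + _ = (0 : R)
    rw [ha.2 b h, hb.2 b h, add_zero]⟩
  neg_mem' ha := ⟨neg_mem ha.1, fun b h => neg_eq_zero.2 (ha.2 b h)⟩

/-- The image of `kerSums I` in `R[[P]]`. -/
noncomputable def kerSpan (I : Submodule Rᵐᵒᵖ R) : AddSubgroup (FormalSums R P) :=
  (P.kerSums I).map (joinHom R P)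

theorem scale_mem_kerSpan {I : Submodule Rᵐᵒᵖ R} {r : R} (hr : r ∈ I) {a : FormalSums R P}
    (ha : P.π a = 0) : scale r a ∈ P.kerSpan I := by
  refine ⟨scale r (point a), ⟨scale_mem_coeffIn hr _, fun b hb => ?_⟩, ?_⟩
  · rw [scale_apply, point_apply_of_ne, mul_zero]
    rintro rfl
    exact hb ha
  · exact (join_scale _ _).trans (by rw [join_point])

theorem π_eq_zero_of_mem_kerSpan {I : Submodule Rᵐᵒᵖ R} {a : FormalSums R P}
    (ha : a ∈ P.kerSpan I) : P.π a = 0 := by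
  obtain ⟨c, hc, rfl⟩ := ha
  exact P.π_join_eq_zero hc.2

/-! ### Flatness and the correction step. -/

/-- Both subgroups in the quotient are forced: J[[P]] makes l·p depend only on l modulo J, and
`kerSpan I` gives additivity in p, since the point measure of p + q differs from the sum of those of
p and q by an element of K. -/
theorem exists_addMonoidHom_quotient_tensor (I J : Submodule Rᵐᵒᵖ R) :
    ∃ φ : (I ⧸ J.submoduleOf I) ⊗[ℤ] P →+ FormalSums R P ⧸ (coeffIn J P ⊔ P.kerSpan I),
      ∀ (l : I) (p : P), φ ((J.submoduleOf I).mkQ l ⊗ₜ p) =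
        QuotientAddGroup.mk (scale l.1 (point p)) := by
  let β : I →+ P →+ FormalSums R P ⧸ (coeffIn J P ⊔ P.kerSpan I) :=
    AddMonoidHom.mk' (fun l => AddMonoidHom.mk'
      (fun p => QuotientAddGroup.mk (scale l.1 (point p)))
      (fun p q => by
        rw [← QuotientAddGroup.mk_add, eq_comm, QuotientAddGroup.eq]
        refine AddSubgroup.mem_sup_right ?_
        rw [← _root_.map_add, ← _root_.map_neg, ← _root_.map_add]
        refine P.scale_mem_kerSpan l.2 ?_
        rw [← πHom_apply, _root_.map_add, _root_.map_neg, _root_.map_add]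
        simp only [πHom_apply, contraunit]
        exact neg_add_cancel _))
      (fun l m => AddMonoidHom.ext fun p => by
        change QuotientAddGroup.mk (scale (l.1 + m.1) (point p)) = _
        rw [_root_.map_add]
        rfl)
  let γ : (I ⧸ J.submoduleOf I) →+ P →+ FormalSums R P ⧸ (coeffIn J P ⊔ P.kerSpan I) :=
    QuotientAddGroup.lift (J.submoduleOf I).toAddSubgroup β (fun l hl =>
      AddMonoidHom.ext fun p => (QuotientAddGroup.eq_zero_iff _).2 <|
        AddSubgroup.mem_sup_left (scale_mem_coeffIn hl _))
  refine ⟨TensorProduct.liftAddHom γ fun r m n => ?_, fun l p => rfl⟩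
  rw [map_zsmul, map_zsmul, AddMonoidHom.zsmul_apply]

/-- Modulo J[[P]] only the finitely many x with l * r x ∉ J survive. -/
theorem mk_scale_map_eq_finsum {I J : Submodule Rᵐᵒᵖ R} (hJ : IsOpen (J : Set R))
    {X : Type v} (l : R) (r : FormalSums R X) (p : X → P) :
    (QuotientAddGroup.mk (scale l (map p r)) :
        FormalSums R P ⧸ (coeffIn J P ⊔ P.kerSpan I)) =
      ∑ᶠ x, QuotientAddGroup.mk (scale (l * r.1 x) (point (p x))) := by
  have hfin := tendsto_zero_iff.1 (scale l r).2 J hJ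
  rw [finsum_eq_sum_of_support_subset (s := hfin.toFinset)]
  · have h := map_sub_sum_scale_point_mem hJ p (scale l r) hfin.toFinset fun x hx => by
      simpa using hx
    rw [map_scale] at h
    have e := map_sum (QuotientAddGroup.mk' (coeffIn J P ⊔ P.kerSpan I))
      (fun x => scale (l * r.1 x) (point (p x))) hfin.toFinset
    refine Eq.trans ?_ e
    refine (QuotientAddGroup.eq_iff_sub_mem).2 (AddSubgroup.mem_sup_left h)
  · intro x hx
    rw [Set.Finite.coe_toFinset]
    exact fun h => hx <| (QuotientAddGroup.eq_zero_iff _).2 <|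
      AddSubgroup.mem_sup_left (scale_mem_coeffIn h _)

/-- Thus φ descends to the contratensor product: l·(point of π(a)) and l·a differ by l times an
element of K, which lies in `kerSpan I`. -/
theorem map_contratensorRelations_eq_zero {I J : Submodule Rᵐᵒᵖ R} (hJ : IsOpen (J : Set R))
    [hD : IsDiscreteRightModule R (I ⧸ J.submoduleOf I)]
    {φ : (I ⧸ J.submoduleOf I) ⊗[ℤ] P →+ FormalSums R P ⧸ (coeffIn J P ⊔ P.kerSpan I)}
    (hφ : ∀ (l : I) (p : P), φ ((J.submoduleOf I).mkQ l ⊗ₜ p) =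
        QuotientAddGroup.mk (scale l.1 (point p)))
    {t : (I ⧸ J.submoduleOf I) ⊗[ℤ] P} (ht : t ∈ P.contratensorRelations (I ⧸ J.submoduleOf I)) :
    φ t = 0 := by
  suffices P.contratensorRelations (I ⧸ J.submoduleOf I) ≤ φ.ker from this ht
  refine (AddSubgroup.closure_le _).2 ?_
  rintro _ ⟨b, X, r, p, rfl⟩
  obtain ⟨l, rfl⟩ := (J.submoduleOf I).mkQ_surjective b
  change φ _ = 0
  rw [map_sub, AddMonoidHom.map_finsum, hφ, sub_eq_zero]
  · have h : ∀ x, φ ((op (r.1 x) • (J.submoduleOf I).mkQ l) ⊗ₜ[ℤ] p x) =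
        QuotientAddGroup.mk (scale (l.1 * r.1 x) (point (p x))) := fun x => by
      rw [← map_smul, hφ]
      rfl
    rw [finsum_congr h, ← P.mk_scale_map_eq_finsum hJ, QuotientAddGroup.eq_iff_sub_mem, ← map_sub]
    refine AddSubgroup.mem_sup_right (P.scale_mem_kerSpan l.2 ?_)
    rw [← πHom_apply, map_sub, πHom_apply, πHom_apply, contraunit]
    exact sub_self _
  · refine (finite_support_smul r ((J.submoduleOf I).mkQ l)).subset fun x hx h0 => hx ?_
    exact (congrArg (· ⊗ₜ[ℤ] p x) h0).trans (TensorProduct.zero_tmul _ _)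

/-- The defining relation for the tautological family indexed by P itself. -/
theorem mk_tmul_π {N : Type v} [AddCommGroup N] [Module Rᵐᵒᵖ N] [IsDiscreteRightModule R N]
    (b : N) (a : FormalSums R P) (s : Finset P) (hs : ∀ x ∉ s, op (a.1 x) • b = 0) :
    (QuotientAddGroup.mk (b ⊗ₜ[ℤ] P.π a) : P.Contratensor N) =
      QuotientAddGroup.mk (∑ x ∈ s, (op (a.1 x) • b) ⊗ₜ[ℤ] x) := by
  have hid : map id a = a := by
    refine Subtype.ext <| funext fun y => ?_
    refine (tsum_eq_single (⟨y, rfl⟩ : {x // id x = y}) fun z hz => ?_)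
    exact absurd (Subtype.ext z.2) hz
  rw [QuotientAddGroup.eq_iff_sub_mem]
  refine AddSubgroup.subset_closure ⟨b, P, a, id, ?_⟩
  rw [infSum, hid, finsum_eq_sum_of_support_subset (s := s)]
  · rfl
  · intro x hx
    by_contra h
    refine hx ?_
    change (op (a.1 x) • b) ⊗ₜ[ℤ] x = 0
    rw [hs x h, TensorProduct.zero_tmul]

theorem mem_sup_of_π_mem_tim {P : LeftContramodule R} (hP : P.IsFlat) {I J : Submodule Rᵐᵒᵖ R}
    (hJ : IsOpen (J : Set R)) {a : FormalSums R P} (ha : a ∈ coeffIn I P)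
    (hπ : P.π a ∈ P.tim J) : a ∈ coeffIn J P ⊔ P.kerSpan I := by
  have hM : IsDiscreteRightModule R (R ⧸ J) := .quotient hJ
  let f : (I ⧸ J.submoduleOf I) →ₗ[Rᵐᵒᵖ] (R ⧸ J) := (J.submoduleOf I).mapQ J I.subtype le_rfl
  have hf : Function.Injective f := by
    rw [← LinearMap.ker_eq_bot]
    exact Submodule.ker_liftQ_eq_bot _ _ _ (by rw [LinearMap.ker_comp, Submodule.ker_mkQ]; rfl)
  have hL : IsDiscreteRightModule R (I ⧸ J.submoduleOf I) := .of_injective f hf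
  -- The cokernel of f completes the short exact sequence that flatness requires.
  have hN : IsDiscreteRightModule R ((R ⧸ J) ⧸ LinearMap.range f) :=
    .of_surjective (LinearMap.range f).mkQ (Submodule.mkQ_surjective _)
  have inj := (hP _ _ _ f (LinearMap.range f).mkQ hf (LinearMap.exact_map_mkQ_range f)
    (Submodule.mkQ_surjective _)).1
  obtain ⟨φ, hφ⟩ := P.exists_addMonoidHom_quotient_tensor I J
  have hfin := tendsto_zero_iff.1 a.2 J hJ
  set s := hfin.toFinset with hs
  have hmem : ∀ x ∉ s, a.1 x ∈ J := fun x hx => by simpa [hs] using hx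
  have hop : ∀ r : R, op r • J.mkQ (1 : R) = J.mkQ r := fun r => by
    rw [← map_smul, op_smul_eq_mul, one_mul]
  let t : (I ⧸ J.submoduleOf I) ⊗[ℤ] P :=
    ∑ x ∈ s, (J.submoduleOf I).mkQ ⟨a.1 x, ha x⟩ ⊗ₜ[ℤ] x
  have hφt : φ t = QuotientAddGroup.mk a := by
    have h := sub_sum_scale_point_mem a s hmem
    rw [map_sum, Finset.sum_congr rfl fun x _ => hφ _ x]
    have e := map_sum (QuotientAddGroup.mk' (coeffIn J P ⊔ P.kerSpan I))
      (fun x => scale (a.1 x) (point x)) s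
    refine e.symm.trans (Eq.symm ?_)
    exact (QuotientAddGroup.eq_iff_sub_mem).2 (AddSubgroup.mem_sup_left h)
  have ht : (QuotientAddGroup.mk t : P.Contratensor (I ⧸ J.submoduleOf I)) = 0 := by
    refine inj ?_
    rw [map_zero]
    -- The right side represents 1 ⊙ π(a). Expanding π(a) instead through some b ∈ J[[P]] leaves an
    -- empty sum, since J kills the class of 1 in R/J.
    have e : P.contratensorMap f (QuotientAddGroup.mk t) =
        QuotientAddGroup.mk (∑ x ∈ s, (op (a.1 x) • J.mkQ (1 : R)) ⊗ₜ[ℤ] x) := by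
      refine congrArg QuotientAddGroup.mk ?_
      change LinearMap.rTensor P f.toAddMonoidHom.toIntLinearMap t = _
      rw [map_sum]
      refine Finset.sum_congr rfl fun x _ => ?_
      rw [hop]
      rfl
    rw [e, ← P.mk_tmul_π _ a s fun x hx => by
      rw [hop]; exact (Submodule.Quotient.mk_eq_zero J).2 (hmem x hx)]
    obtain ⟨b, hb, hba⟩ := hπ
    rw [← hba, P.mk_tmul_π _ b ∅ fun x _ => by
      rw [hop]; exact (Submodule.Quotient.mk_eq_zero J).2 (hb x)]
    rfl
  rw [← QuotientAddGroup.eq_zero_iff, ← hφt]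
  exact P.map_contratensorRelations_eq_zero hJ hφ ((QuotientAddGroup.eq_zero_iff _).1 ht)

/-! ### Iteration along a countable base. -/

theorem eq_zero_of_forall_mem_tim {P : LeftContramodule R} (hP : P.IsFlat) {I : ℕ → Submodule Rᵐᵒᵖ R}
    (hI : (𝓝 (0 : R)).HasAntitoneBasis fun n => (I n : Set R))
    (hIo : ∀ n, IsOpen (I n : Set R)) {q : P} (hq : ∀ n, q ∈ P.tim (I n)) : q = 0 := by
  have step : ∀ (n : ℕ) (a : {a // a ∈ coeffIn (I n) P ∧ P.π a = q}),
      ∃ a' : {a // a ∈ coeffIn (I (n + 1)) P ∧ P.π a = q}, a.1 - a'.1 ∈ P.kerSpan (I n) := by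
    rintro n ⟨a, ha, haq⟩
    obtain ⟨a', ha', d, hd, rfl⟩ := AddSubgroup.mem_sup.1
      (mem_sup_of_π_mem_tim hP (hIo (n + 1)) ha (haq ▸ hq (n + 1)))
    refine ⟨⟨a', ha', ?_⟩, by simpa using hd⟩
    rw [← haq, P.π_add a' d, P.π_eq_zero_of_mem_kerSpan hd]
    change P.π a' = P.π a' + 0
    rw [add_zero]
  choose next hnext using step
  obtain ⟨a₀, ha₀, haq₀⟩ := hq 0
  let a : ∀ n, {a // a ∈ coeffIn (I n) P ∧ P.π a = q} :=
    fun n => Nat.rec ⟨a₀, ha₀, haq₀⟩ next n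
  have ha : ∀ n, (a n).1 - (a (n + 1)).1 ∈ P.kerSpan (I n) := fun n => hnext n (a n)
  choose c hc hca using ha
  obtain ⟨d, hd, hd0⟩ := exists_sub_sum_range_mem hI hIo c fun n => (hc n).1
  have hsum : ∀ n, joinHom R P (∑ i ∈ Finset.range n, c i) = (a 0).1 - (a n).1 := fun n => by
    rw [map_sum, Finset.sum_congr rfl fun i _ => hca i, Finset.sum_range_sub']
  -- For each n this difference is the image of the tail of d minus aₙ, both in Iₙ[[P]]; R being
  -- Hausdorff, it vanishes.
  have hjoin : joinHom R P d - (a 0).1 = 0 := eq_zero_of_mem_coeffIn hI fun n => by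
    have h : joinHom R P (d - ∑ i ∈ Finset.range n, c i) ∈ coeffIn (I n) P :=
      join_mem_coeffIn (hIo n) (hd n)
    rw [map_sub, hsum] at h
    have h' := sub_mem h (a n).2.1
    rwa [← sub_add, add_sub_cancel_right] at h'
  rw [← (a 0).2.2, ← sub_eq_zero.1 hjoin]
  exact P.π_join_eq_zero fun b hb => hd0 b fun n => (hc n).2 b hb

end LeftContramodule

end Contra

theorem mainTheorem7 {R : Type u} [Ring R] [UniformSpace R] [IsUniformAddGroup R]
    [IsTopologicalRing R] [IsLinearTopology Rᵐᵒᵖ R] [(𝓝 (0 : R)).IsCountablyGenerated]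
    [CompleteSpace R] [T2Space R] (P : Contra.LeftContramodule R) (hP : P.IsFlat) :
    P.IsSeparated := by
  -- Countability of the base lets the successive corrections run along ℕ.
  obtain ⟨I, hIo, hI⟩ :=
    (IsLinearTopology.hasBasis_open_submodule (M := R) Rᵐᵒᵖ).exists_antitone_subbasis
  refine (AddSubgroup.eq_bot_iff_forall _).2 fun q hq => ?_
  simp only [AddSubgroup.mem_iInf] at hq
  exact Contra.LeftContramodule.eq_zero_of_forall_mem_tim hP hI hIo fun n => hq (I n) (hIo n)
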